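/- **Setting.** Let $\mathcal M\subseteq\mathbb R^{m\times n}\cong\mathbb R^{r}$, $r=mn$, be a smooth embedded submanifold with the metric induced by the Frobenius inner product, and let $R:T\mathcal M\to\mathcal M$ be a retraction, i.e. a smooth map with $R_\theta(0)=\theta$ and $\frac{\mathrm d}{\mathrm dt}R_\theta(t\xi)|_{t=0}=\xi$ for all $\theta\in\mathcal M$, $\xi\in T_\theta\mathcal M$. Given data $(x_i,y_i)_{i=1}^N$, $N\ge1$, an input-output map $f(x,\theta)$ and conditional densities $p(y|z)$, let $\Psi(\theta)=-\frac1N\sum_{i=1}^N\log p(y_i|f(x_i,\theta))$, assumed smooth on $\mathcal M$. Write $\mathrm{grad}\,u(\theta)$ for the orthogonal projection of $\nabla u(\theta)$ onto $T_\theta\mathcal M$. With $s_\theta(x,y)=\mathrm{grad}_\theta\log p(y|f(x,\theta))$, the Riemannian Fisher information matrix (RFIM) is $F^R(\theta)=\frac1N\sum_i\mathbb E_{y\sim p(\cdot|f(x_i,\theta))}[s_\theta(x_i,y)s_\theta(x_i,y)^\top]$ and the empirical one (REFIM) is $\bar F^R(\theta)=\frac1N\sum_i s_\theta(x_i,y_i)s_\theta(x_i,y_i)^\top$.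 **Algorithm.** Let $\theta^0\in\mathcal M$, $\sigma_0>0$, $\sigma_{\min}>0$, $\eta_1\in(0,1)$, $\eta_2>0$, $\gamma>1$. In iteration $k=0,1,2,\dots$ the method obtains a (random) vector $g^k\in T_{\theta^k}\mathcal M$, a (random) matrix $F_k\in\mathbb R^{r\times r}$ that is the RFIM or the REFIM at $\theta^k$ or a symmetric positive semidefinite estimate of one of them, and (random) estimates $\Psi_k^0$ of $\Psi(\theta^k)$ and $\Psi_k^{z^k}$ of $\Psi(z^k)$. With $\lambda_k=\sigma_k\|g^k\|$ it sets $$d^k\in\operatorname*{argmin}_{d\in T_{\theta^k}\mathcal M}m_k(d),\qquad m_k(d)=\Psi_k^0+\langle g^k,d\rangle+\tfrac12\langle(F_k+\lambda_kI)d,d\rangle,$$ $$z^k=R_{\theta^k}(d^k),\qquad \rho_k=\frac{\Psi_k^{z^k}-\Psi_k^0}{m_k(d^k)-\Psi_k^0};$$ $\theta^{k+1}=z^k$ if $\rho_k\ge\eta_1$ and $\|g^k\|\ge\eta_2/\sigma_k$, and $\theta^{k+1}=\theta^k$ otherwise; $\sigma_{k+1}=\max\{\sigma_{\min},\sigma_k/\gamma\}$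 if $\rho_k\ge\eta_1$ and $\|g^k\|>\eta_2/\sigma_k$, and $\sigma_{k+1}=\gamma\sigma_k$ otherwise. (If $m_k(d^k)=\Psi_k^0$, then $g^k=0$ and the trial point is rejected.) **Theorem.** Write $B_\theta(0,\rho)=\{d\in T_\theta\mathcal M:\|d\|\le\rho\}$. Let $L\ge0$, $\kappa_{\rm fim}\in\mathbb R$ and $\kappa_{\rm ef},\kappa_{\rm eg},\epsilon_F>0$ be constants, and suppose that almost surely: 1. $\inf_k\Psi(\theta^k)>-\infty$, and for every $k$ the function $\Psi\circ R_{\theta^k}$ and its gradient $\nabla(\Psi\circ R_{\theta^k})$ are $L$-Lipschitz on $B_{\theta^k}(0,1/\sigma_{\min})$; 2. $\|F_k\|_{\rm op}\le\kappa_{\rm fim}$ for all $k$; 3. for every $k$, $q=m_k$ is a $(\kappa_{\rm ef},\kappa_{\rm eg})$-fully linear model of $\Psi$, i.e. for all $y\in B_{\theta^k}(0,1/\sigma_k)$ $$\|\nabla(\Psi\circ R_{\theta^k})(y)-\nabla q(y)\|\le\frac{\kappa_{\rm eg}}{\sigma_k},\qquad |\Psi\circ R_{\theta^k}(y)-q(y)|\le\frac{\kappa_{\rm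 ef}}{\sigma_k^2};$$ it also suffices that, instead of $m_k$, its part without the regularization term, $q(d)=\Psi_k^0+\langle g^k,d\rangle+\frac12\langle F_kd,d\rangle$, has this property; 4. the estimates are $\epsilon_F$-accurate: $|\Psi_k^0-\Psi(\theta^k)|\le\epsilon_F/\sigma_k^2$ and $|\Psi_k^{z^k}-\Psi(z^k)|\le\epsilon_F/\sigma_k^2$ for every $k$. Suppose moreover that $\eta_2\ge\max\{\kappa_{\rm fim},\frac{16\kappa_{\rm ef}}{1-\eta_1}\}$ and $\epsilon_F\le\min\{\kappa_{\rm ef},\frac1{32}\eta_1\eta_2\}$. Then, almost surely, $$\liminf_{k\to\infty}\|\mathrm{grad}\,\Psi(\theta^k)\|=0 .$$ -/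

import Mathlib

open Filter Topology MeasureTheory
open scoped NNReal ENNReal

noncomputable section

open scoped ContDiff

namespace RNGD

/-- The space of real `m × n` matrices, identified with `ℝ^r`, `r = m n`, through vectorization;
its Euclidean norm is the Frobenius norm. -/
abbrev MatrixSpace (m n : ℕ) : Type := EuclideanSpace ℝ (Fin m × Fin n)

section Geometry

variable {E : Type*} [NormedAddCommGroup E] [InnerProductSpace ℝ E]

/-- Smoothness of a map on an arbitrary subset: near each point of the subset the map agrees
with a smooth map defined on an open set. -/
def IsSmoothOn {G H : Type*} [NormedAddCommGroup G] [NormedSpace ℝ G]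
    [NormedAddCommGroup H] [NormedSpace ℝ H] (s : Set G) (u : G → H) : Prop :=
  ∀ x ∈ s, ∃ U : Set G, IsOpen U ∧ x ∈ U ∧
    ∃ v : G → H, ContDiffOn ℝ ∞ v U ∧ Set.EqOn u v (s ∩ U)

/-- `M` is a (smooth) embedded submanifold of `E`, of some codimension `k`: near each of its
points it is the zero set of a smooth map to `ℝ^k` with surjective differential. -/
def IsEmbeddedSubmanifold (M : Set E) : Prop :=
  ∃ k : ℕ, ∀ x ∈ M, ∃ U : Set E, IsOpen U ∧ x ∈ U ∧
    ∃ h : E → EuclideanSpace ℝ (Fin k), ContDiffOn ℝ ∞ h U ∧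
      M ∩ U = {y ∈ U | h y = 0} ∧ Function.Surjective (fderiv ℝ h x)

/-- Velocities at `x` of smooth curves in `M` through `x`. -/
def curveVelocities (M : Set E) (x : E) : Set E :=
  {v | ∃ ε > (0 : ℝ), ∃ c : ℝ → E, ContDiffOn ℝ ∞ c (Set.Ioo (-ε) ε) ∧
    (∀ t ∈ Set.Ioo (-ε) ε, c t ∈ M) ∧ c 0 = x ∧ HasDerivAt c v 0}

/-- The tangent space `T_x M`. (On an embedded submanifold the velocities already form a linear
subspace, and the span adds nothing.) It carries the inner product of `E`, which is the
Riemannian metric. -/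
def tangentSubspace (M : Set E) (x : E) : Submodule ℝ E :=
  Submodule.span ℝ (curveVelocities M x)

/-- The tangent bundle as a subset of `E × E`. -/
def tangentPairs (M : Set E) : Set (E × E) :=
  {q | q.1 ∈ M ∧ q.2 ∈ tangentSubspace M q.1}

/-- A retraction on `M`. Only the values `R θ d` with `θ ∈ M` and `d ∈ T_θ M` matter. -/
structure IsRetraction (M : Set E) (R : E → E → E) : Prop where
  maps_to : ∀ θ ∈ M, ∀ d ∈ tangentSubspace M θ, R θ d ∈ M
  smooth : IsSmoothOn (tangentPairs M) (fun q : E × E => R q.1 q.2)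
  map_zero : ∀ θ ∈ M, R θ 0 = θ
  deriv_zero : ∀ θ ∈ M, ∀ ξ ∈ tangentSubspace M θ,
    HasDerivAt (fun t : ℝ => R θ (t • ξ)) ξ 0

/-- The pull-back `Ψ ∘ R_θ : T_θ M → ℝ`. -/
def pullback (M : Set E) (Ψ : E → ℝ) (R : E → E → E) (θ : E) : tangentSubspace M θ → ℝ :=
  fun d => Ψ (R θ d)

/-- The closed ball `B_θ(0, ρ)` in the tangent space at `θ`. -/
def tangentBall (M : Set E) (θ : E) (ρ : ℝ) : Set (tangentSubspace M θ) :=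
  {d | ‖d‖ ≤ ρ}

variable [FiniteDimensional ℝ E]

/-- The Riemannian gradient of `u : M → ℝ` at `θ ∈ M`: the orthogonal projection to `T_θ M` of
the Euclidean gradient. Since `u` need only be meaningful on `M`, the Euclidean gradient is
taken relative to `M`; it is then determined up to a vector orthogonal to `T_θ M`, which the
projection removes. -/
def riemGrad (M : Set E) (u : E → ℝ) (θ : E) : tangentSubspace M θ :=
  (tangentSubspace M θ).orthogonalProjectionOnto (gradientWithin u M θ)

end Geometry

/-- A learning problem: data `(x_i, y_i)`, `1 ≤ i ≤ N`, an input-output map `f(x, θ)`, and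
conditional probability densities `p(y | z)` with respect to a reference measure on `Y`
(the counting measure when `Y` is discrete). -/
structure LearningProblem (E X Y Z : Type*) [MeasurableSpace Y] where
  N : ℕ
  N_pos : 0 < N
  x : Fin N → X
  y : Fin N → Y
  f : X → E → Z
  refMeasure : Measure Y
  p : Y → Z → ℝ
  p_nonneg : ∀ y z, 0 ≤ p y z
  p_measurable : ∀ z, Measurable fun y => p y z
  p_total : ∀ z, ∫⁻ y, ENNReal.ofReal (p y z) ∂refMeasure = 1

section Fisher

variable {E X Y Z : Type*} [MeasurableSpace Y]

/-- The objective `Ψ(θ) = -(1/N) ∑ log p(y_i | f(x_i, θ))`. -/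
def LearningProblem.loss (Q : LearningProblem E X Y Z) (θ : E) : ℝ :=
  -((Q.N : ℝ)⁻¹ * ∑ i, Real.log (Q.p (Q.y i) (Q.f (Q.x i) θ)))

variable [NormedAddCommGroup E] [InnerProductSpace ℝ E] [FiniteDimensional ℝ E]

/-- The score vector `grad log p(y | f(x, θ))`, as a vector of the ambient space. -/
def LearningProblem.score (Q : LearningProblem E X Y Z) (M : Set E) (x : X) (y : Y) (θ : E) : E :=
  (riemGrad M (fun θ' => Real.log (Q.p y (Q.f x θ'))) θ : E)

/-- The Riemannian Fisher information matrix (RFIM), with the empirical distribution of the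
inputs and the model distribution of the outputs. -/
def LearningProblem.rfim (Q : LearningProblem E X Y Z) (M : Set E) (θ : E) : E →L[ℝ] E :=
  (Q.N : ℝ)⁻¹ • ∑ i, ∫ y, Q.p y (Q.f (Q.x i) θ) •
    InnerProductSpace.rankOne ℝ (Q.score M (Q.x i) y θ) (Q.score M (Q.x i) y θ) ∂Q.refMeasure

/-- The Riemannian empirical Fisher information matrix (REFIM). -/
def LearningProblem.refim (Q : LearningProblem E X Y Z) (M : Set E) (θ : E) : E →L[ℝ] E :=
  (Q.N : ℝ)⁻¹ • ∑ i,
    InnerProductSpace.rankOne ℝ (Q.score M (Q.x i) (Q.y i) θ) (Q.score M (Q.x i) (Q.y i) θ)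

/-- The matrices `F` that the algorithm may use at `θ`: the RFIM, the REFIM, or an estimate of
one of them, about which nothing is required except that it is symmetric positive
semidefinite (so that `F + λ I` is positive definite for `λ > 0`). -/
def LearningProblem.IsFisherEstimate (Q : LearningProblem E X Y Z) (M : Set E) (θ : E)
    (F : E →L[ℝ] E) : Prop :=
  F = Q.rfim M θ ∨ F = Q.refim M θ ∨ F.IsPositive

end Fisher

section Algorithm

variable {E : Type*} [NormedAddCommGroup E] [InnerProductSpace ℝ E]

/-- The quadratic model `d ↦ a + ⟨g, d⟩ + ½ ⟨(F + lam I) d, d⟩` on `T_θ M`. -/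
def quadModel (M : Set E) (θ : E) (a : ℝ) (g : E) (F : E →L[ℝ] E) (lam : ℝ) :
    tangentSubspace M θ → ℝ :=
  fun d => a + inner ℝ g (d : E) + 1 / 2 * inner ℝ (F (d : E) + lam • (d : E)) (d : E)

/-- The sequences produced by a run of the algorithm, indexed by the iteration `k`. -/
structure Trajectory (E : Type*) [NormedAddCommGroup E] [InnerProductSpace ℝ E] where
  /-- the iterates `θ^k` -/
  θ : ℕ → E
  /-- the parameters `σ_k` -/
  σ : ℕ → ℝ
  /-- the estimated Riemannian gradients `g^k` -/
  g : ℕ → E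
  /-- the estimated Riemannian Fisher information matrices `F_k` -/
  F : ℕ → E →L[ℝ] E
  /-- the directions `d^k` -/
  d : ℕ → E
  /-- the estimates `Ψ_k^0` of `Ψ(θ^k)` -/
  est0 : ℕ → ℝ
  /-- the estimates `Ψ_k^{z^k}` of `Ψ(z^k)` -/
  estz : ℕ → ℝ

namespace Trajectory

variable (t : Trajectory E) (M : Set E) (R : E → E → E) (k : ℕ)

/-- The regularization parameter `λ_k = σ_k ‖g^k‖`. -/
def lam : ℝ := t.σ k * ‖t.g k‖

/-- The regularized model `m_k`, with `Ψ_k = Ψ_k^0`. -/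
def model : tangentSubspace M (t.θ k) → ℝ :=
  quadModel M (t.θ k) (t.est0 k) (t.g k) (t.F k) (t.lam k)

/-- The model `m_k` without its regularization term `½ λ_k ‖d‖²`. -/
def plainModel : tangentSubspace M (t.θ k) → ℝ :=
  quadModel M (t.θ k) (t.est0 k) (t.g k) (t.F k) 0

/-- The trial point `z^k`. -/
def trial : E := R (t.θ k) (t.d k)

/-- The predicted change `m_k(d^k) - Ψ_k^0`. -/
def predicted : ℝ :=
  inner ℝ (t.g k) (t.d k) + 1 / 2 * inner ℝ (t.F k (t.d k) + t.lam k • t.d k) (t.d k)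

/-- The ratio `ρ_k`. (If the denominator vanishes then `g^k = 0`, and the trial point is
rejected whatever `ρ_k` is.) -/
def ratio : ℝ := (t.estz k - t.est0 k) / t.predicted k

end Trajectory

variable [FiniteDimensional ℝ E]

open Classical in
/-- `t` is a run of the adaptively regularized Riemannian natural gradient descent method. -/
structure IsRun {X Y Z : Type*} [MeasurableSpace Y] (Q : LearningProblem E X Y Z) (M : Set E)
    (R : E → E → E) (θ₀ : E) (σ₀ σmin η₁ η₂ γ : ℝ) (t : Trajectory E) : Prop where
  θ_zero : t.θ 0 = θ₀
  σ_zero : t.σ 0 = σ₀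
  g_mem : ∀ k, t.g k ∈ tangentSubspace M (t.θ k)
  F_est : ∀ k, Q.IsFisherEstimate M (t.θ k) (t.F k)
  /-- `d^k` minimizes `m_k` over the tangent space at `θ^k` -/
  d_argmin : ∀ k, ∃ hd : t.d k ∈ tangentSubspace M (t.θ k),
    IsMinOn (t.model M k) Set.univ ⟨t.d k, hd⟩
  θ_succ : ∀ k, t.θ (k + 1) =
    if η₁ ≤ t.ratio k ∧ η₂ / t.σ k ≤ ‖t.g k‖ then t.trial R k else t.θ k
  σ_succ : ∀ k, t.σ (k + 1) =
    if η₁ ≤ t.ratio k ∧ η₂ / t.σ k < ‖t.g k‖ then max σmin (1 / γ * t.σ k) else γ * t.σ k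

/-- `q` is a `(κef, κeg)`-fully linear model of `Ψ` on `B_θ(0, 1/σ)`. Gradients are those of
functions on the Euclidean space `T_θ M`. -/
def IsFullyLinear (M : Set E) (Ψ : E → ℝ) (R : E → E → E) (κef κeg : ℝ) (θ : E) (σ : ℝ)
    (q : tangentSubspace M θ → ℝ) : Prop :=
  ∀ y ∈ tangentBall M θ (1 / σ),
    ‖gradient (pullback M Ψ R θ) y - gradient q y‖ ≤ κeg / σ ∧
    |pullback M Ψ R θ y - q y| ≤ κef / σ ^ 2

/-- The estimates of `Ψ(θ^k)` and `Ψ(z^k)` in iteration `k` are `εF`-accurate. -/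
def Trajectory.IsAccurate (t : Trajectory E) (Ψ : E → ℝ) (R : E → E → E) (εF : ℝ) (k : ℕ) :
    Prop :=
  |t.est0 k - Ψ (t.θ k)| ≤ εF / t.σ k ^ 2 ∧
    |t.estz k - Ψ (t.trial R k)| ≤ εF / t.σ k ^ 2

/-- `Ψ` is bounded below along the iterates, and `Ψ ∘ R` and its gradient are `L`-Lipschitz on
the tangent balls of radius `1/σmin` at the iterates. -/
def Trajectory.IsRegular (t : Trajectory E) (M : Set E) (Ψ : E → ℝ) (R : E → E → E)
    (σmin : ℝ) (L : ℝ≥0) : Prop :=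
  BddBelow (Set.range fun k => Ψ (t.θ k)) ∧
    ∀ k, LipschitzOnWith L (pullback M Ψ R (t.θ k)) (tangentBall M (t.θ k) (1 / σmin)) ∧
      LipschitzOnWith L (gradient (pullback M Ψ R (t.θ k))) (tangentBall M (t.θ k) (1 / σmin))

end Algorithm

end RNGD

end

open RNGD

open RNGD

namespace RNGD

/-! ### First-order behaviour of pullbacks and models at the origin. -/

section Geometry

variable {E : Type*} [NormedAddCommGroup E] [InnerProductSpace ℝ E]

/-! The argument is deterministic along each path; probability only intersects almost sure events.
If `‖g^k‖ ≥ η₂/σ_k`, then `λ_k ≥ η₂ ≥ ‖F_k‖`, so the model decreases by at least `η₂/(4σ_k²)`, and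
`‖d^k‖ ≤ 1/σ_k` keeps the step where the model is fully linear. Two consequences conflict when the
gradient stays away from zero. First, accepted steps lower the loss by a multiple of `1/σ_k²`. The
loss is monotone and bounded below, so its decreases tend to 0 and `σ_k` can shrink only where it is
already large; hence `σ_k → ∞` (`IsRun.tendsto_σ`). Second, if `‖grad Ψ‖ ≥ ε` eventually, full
linearity gives `‖g^k‖ > η₂/σ_k` for large `σ_k`; every late iteration is then successful
(`IsRun.le_ratio`) and `σ_k` stays bounded. -/

theorem IsSmoothOn.differentiableWithinAt {G H : Type*} [NormedAddCommGroup G] [NormedSpace ℝ G]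
    [NormedAddCommGroup H] [NormedSpace ℝ H] {s : Set G} {u : G → H} (hu : IsSmoothOn s u)
    {x : G} (hx : x ∈ s) : DifferentiableWithinAt ℝ u s x := by
  obtain ⟨U, hU, hxU, v, hv, huv⟩ := hu x hx
  have hd : DifferentiableAt ℝ v x :=
    ((hv.contDiffAt (hU.mem_nhds hxU)).differentiableAt (by simp))
  have h1 : DifferentiableWithinAt ℝ u (s ∩ U) x :=
    hd.differentiableWithinAt.congr huv (huv ⟨hx, hxU⟩)
  exact (differentiableWithinAt_inter (hU.mem_nhds hxU)).1 h1

/-- The map `d ↦ (θ, d)` lands in the tangent bundle, so composition turns a derivative within that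
set into a full one; rays then identify it. -/
theorem IsRetraction.hasFDerivAt_zero {M : Set E} {R : E → E → E} (hR : IsRetraction M R)
    {θ : E} (hθ : θ ∈ M) :
    HasFDerivAt (fun d : tangentSubspace M θ => R θ d) (tangentSubspace M θ).subtypeL 0 := by
  have h0 : ((θ, 0) : E × E) ∈ tangentPairs M := ⟨hθ, Submodule.zero_mem _⟩
  have hd : DifferentiableAt ℝ (fun d : tangentSubspace M θ => R θ d) 0 := by
    have h1 := hR.smooth.differentiableWithinAt h0
    have h2 : HasFDerivAt (fun d : tangentSubspace M θ => ((θ, (d : E)) : E × E))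
        ((0 : tangentSubspace M θ →L[ℝ] E).prod (tangentSubspace M θ).subtypeL) 0 :=
      (hasFDerivAt_const θ _).prodMk (tangentSubspace M θ).subtypeL.hasFDerivAt
    exact (HasFDerivWithinAt.comp_hasFDerivAt (t := tangentPairs M) (0 : tangentSubspace M θ)
      (f := fun d : tangentSubspace M θ => ((θ, (d : E)) : E × E))
      h1.hasFDerivWithinAt h2 (Eventually.of_forall fun d => ⟨hθ, d.2⟩)).differentiableAt
  have h3 := hd.hasFDerivAt
  convert h3 using 1
  ext ξ
  have h4 : HasDerivAt (fun t : ℝ => t • ξ) ξ 0 := by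
    simpa using (hasDerivAt_id (0 : ℝ)).smul_const ξ
  have h5 : HasDerivAt (fun t : ℝ => R θ (t • (ξ : E)))
      (fderiv ℝ (fun d : tangentSubspace M θ => R θ d) 0 ξ) 0 :=
    HasFDerivAt.comp_hasDerivAt_of_eq (f := fun t : ℝ => t • ξ) 0 h3 h4 (by simp)
  exact (hR.deriv_zero θ hθ ξ ξ.2).unique h5

variable [FiniteDimensional ℝ E]

/-- This is the chain rule tested on tangent vectors. Both sides use the same `fderivWithin`, so its
non-uniqueness is harmless. -/
theorem gradient_pullback_zero {M : Set E} {R : E → E → E} (hR : IsRetraction M R)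
    {Ψ : E → ℝ} (hΨ : IsSmoothOn M Ψ) {θ : E} (hθ : θ ∈ M) :
    gradient (pullback M Ψ R θ) 0 = riemGrad M Ψ θ := by
  have hz : R θ ((0 : tangentSubspace M θ) : E) = θ := hR.map_zero θ hθ
  have h1 : HasFDerivAt (pullback M Ψ R θ)
      ((fderivWithin ℝ Ψ M θ).comp (tangentSubspace M θ).subtypeL) 0 := by
    refine HasFDerivWithinAt.comp_hasFDerivAt (t := M) (0 : tangentSubspace M θ)
      (f := fun d : tangentSubspace M θ => R θ d) ?_
      (hR.hasFDerivAt_zero hθ) (Eventually.of_forall fun d => hR.maps_to θ hθ d d.2)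
    rw [hz]
    exact (hΨ.differentiableWithinAt hθ).hasFDerivWithinAt
  refine ext_inner_right ℝ fun v => ?_
  rw [inner_gradient_left, h1.fderiv, riemGrad,
    Submodule.inner_orthogonalProjectionOnto_eq_of_mem_right, inner_gradientWithin_left]
  rfl

theorem gradient_quadModel_zero (M : Set E) (θ : E) (a : ℝ) {g : E}
    (hg : g ∈ tangentSubspace M θ) (F : E →L[ℝ] E) (lam : ℝ) :
    gradient (quadModel M θ a g F lam) 0 = ⟨g, hg⟩ := by
  let S : tangentSubspace M θ →L[ℝ] E := (tangentSubspace M θ).subtypeL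
  have hS : HasFDerivAt (fun d : tangentSubspace M θ => (d : E)) S 0 := S.hasFDerivAt
  have hF : HasFDerivAt (fun d : tangentSubspace M θ => F (d : E) + lam • (d : E))
      (F.comp S + lam • S) 0 := (F.comp S + lam • S).hasFDerivAt
  have h := ((((innerSL ℝ g).comp S).hasFDerivAt (x := 0)).const_add a).add
    ((hF.inner ℝ hS).const_mul (1 / 2))
  refine ext_inner_right ℝ fun v => ?_
  have h' : HasFDerivAt (quadModel M θ a g F lam) _ 0 := h
  rw [inner_gradient_left, h'.fderiv]
  simp [S, fderivInnerCLM_apply]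

end Geometry

/-! ### Nonnegativity of the quadratic forms of Fisher matrices. -/

section Fisher

theorem inner_rankOne_self_nonneg {E : Type*} [NormedAddCommGroup E]
    [InnerProductSpace ℝ E] (s v : E) :
    0 ≤ inner ℝ (InnerProductSpace.rankOne ℝ s s v) v := by
  rw [InnerProductSpace.inner_left_rankOne_apply, real_inner_comm s v]
  exact mul_self_nonneg _

variable {E X Y Z : Type*} [MeasurableSpace Y] [NormedAddCommGroup E] [InnerProductSpace ℝ E]
  [FiniteDimensional ℝ E]

theorem LearningProblem.refim_inner_nonneg (Q : LearningProblem E X Y Z) (M : Set E) (θ v : E) :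
    0 ≤ inner ℝ (Q.refim M θ v) v := by
  rw [LearningProblem.refim, smul_apply, sum_apply, real_inner_smul_left,
    sum_inner]
  exact mul_nonneg (by positivity) (Finset.sum_nonneg fun i _ => inner_rankOne_self_nonneg _ _)

theorem LearningProblem.rfim_inner_nonneg (Q : LearningProblem E X Y Z) (M : Set E) (θ v : E) :
    0 ≤ inner ℝ (Q.rfim M θ v) v := by
  rw [LearningProblem.rfim, smul_apply, sum_apply, real_inner_smul_left,
    sum_inner]
  refine mul_nonneg (by positivity) (Finset.sum_nonneg fun i _ => ?_)
  set φ : Y → E →L[ℝ] E := fun y => Q.p y (Q.f (Q.x i) θ) •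
    InnerProductSpace.rankOne ℝ (Q.score M (Q.x i) y θ) (Q.score M (Q.x i) y θ) with hφ
  by_cases hint : Integrable φ Q.refMeasure
  · have h1 := ((innerSL ℝ v).comp (ContinuousLinearMap.apply ℝ E v)).integral_comp_comm hint
    have h2 : inner ℝ ((∫ y, φ y ∂Q.refMeasure) v) v =
        ∫ y, inner ℝ v (φ y v) ∂Q.refMeasure := by
      rw [real_inner_comm]
      exact h1.symm
    rw [h2]
    refine integral_nonneg fun y => ?_
    rw [real_inner_comm, hφ]
    simp only [smul_apply, real_inner_smul_left]
    exact mul_nonneg (Q.p_nonneg _ _) (inner_rankOne_self_nonneg _ _)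
  -- A divergent integral has the default value 0, whose form is still nonnegative.
  · rw [integral_undef hint]
    simp

theorem LearningProblem.IsFisherEstimate.inner_nonneg {Q : LearningProblem E X Y Z} {M : Set E}
    {θ : E} {F : E →L[ℝ] E} (hF : Q.IsFisherEstimate M θ F) (v : E) :
    0 ≤ inner ℝ (F v) v := by
  rcases hF with rfl | rfl | hF
  · exact Q.rfim_inner_nonneg M θ v
  · exact Q.refim_inner_nonneg M θ v
  · simpa using hF.re_inner_nonneg_left v

end Fisher

/-! ### Minimizers of the regularized quadratic model. -/

section Model

variable {E : Type*} [NormedAddCommGroup E] [InnerProductSpace ℝ E] {M : Set E} {θ g : E}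
  {F : E →L[ℝ] E} {a lam : ℝ} {d : tangentSubspace M θ}

/-- Minimality along the ray `(1 + h) • d` gives `⟨g, d⟩ + B = 0`, without symmetry of `F`; then
`lam ‖d‖² ≤ B = -⟨g, d⟩ ≤ ‖g‖ ‖d‖`. For `lam = σ ‖g‖` the bound is `1/σ`. -/
theorem norm_le_of_isMinOn_quadModel (hF : ∀ v, 0 ≤ inner ℝ (F v) v) (hlam : 0 < lam)
    (hd : IsMinOn (quadModel M θ a g F lam) Set.univ d) : ‖d‖ ≤ ‖g‖ / lam := by
  set b := inner ℝ g (d : E) with hb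
  set B := inner ℝ (F (d : E) + lam • (d : E)) (d : E) with hB
  have hquad : ∀ h : ℝ, 0 ≤ B / 2 * (h * h) + (b + B) * h + 0 := fun h => by
    have h1 := isMinOn_iff.1 hd ((1 + h) • d) (Set.mem_univ _)
    have h2 : quadModel M θ a g F lam ((1 + h) • d) = a + (1 + h) * b + (1 + h) ^ 2 * B / 2 := by
      simp only [quadModel, Submodule.coe_smul, map_smul, smul_comm lam (1 + h), ← smul_add,
        real_inner_smul_left, real_inner_smul_right, ← hb, ← hB]
      ring
    have h3 : quadModel M θ a g F lam d = a + b + B / 2 := by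
      simp only [quadModel, ← hb, ← hB]
      ring
    rw [h2, h3] at h1
    linarith
  -- The constant term is 0, so the discriminant is `(b + B)²`.
  have hdis := discrim_le_zero hquad
  have hbB : b + B = 0 := by
    simp only [discrim, mul_zero, sub_zero] at hdis
    exact pow_eq_zero_iff two_ne_zero |>.1 (le_antisymm hdis (sq_nonneg _))
  have hBlow : lam * ‖d‖ ^ 2 ≤ B := by
    rw [hB, inner_add_left, real_inner_smul_left, real_inner_self_eq_norm_sq]
    have := hF d
    simpa using this
  have hblow : -(‖g‖ * ‖d‖) ≤ b := by
    have := abs_real_inner_le_norm g (d : E)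
    exact (abs_le.1 this).1
  rw [le_div_iff₀ hlam]
  rcases (norm_nonneg d).eq_or_lt with h0 | h0
  · rw [← h0]
    simp
  · refine le_of_mul_le_mul_right ?_ h0
    nlinarith

/-- Comparison with `-s g`: the change is at most `(-s + lam s²) ‖g‖²`, smallest at `s = 1/(2 lam)`.
-/
theorem quadModel_decrease_of_isMinOn (hg : g ∈ tangentSubspace M θ) (hlam : 0 < lam)
    (hF : ‖F‖ ≤ lam) (hd : IsMinOn (quadModel M θ a g F lam) Set.univ d) :
    quadModel M θ a g F lam d ≤ a - ‖g‖ ^ 2 / (4 * lam) := by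
  have h1 := isMinOn_iff.1 hd ((-(1 / (2 * lam))) • ⟨g, hg⟩) (Set.mem_univ _)
  refine h1.trans ?_
  have hFg : inner ℝ (F g) g ≤ lam * ‖g‖ ^ 2 := by
    calc inner ℝ (F g) g ≤ ‖F g‖ * ‖g‖ := real_inner_le_norm _ _
      _ ≤ (lam * ‖g‖) * ‖g‖ := by
        gcongr
        exact F.le_of_opNorm_le hF g
      _ = lam * ‖g‖ ^ 2 := by ring
  simp only [quadModel, Submodule.coe_smul, map_smul, inner_add_left, real_inner_smul_left,
    real_inner_smul_right, real_inner_self_eq_norm_sq]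
  have hc : 0 ≤ (1 / (2 * lam)) ^ 2 / 2 := by positivity
  have h2 := mul_le_mul_of_nonneg_left hFg hc
  have h3 : (1 / (2 * lam)) ^ 2 / 2 * (lam * ‖g‖ ^ 2) = ‖g‖ ^ 2 / (8 * lam) := by
    field_simp
    ring
  have h4 : ‖g‖ ^ 2 / (4 * lam) = 2 * (‖g‖ ^ 2 / (8 * lam)) := by
    field_simp
    ring
  have h5 : 1 / (2 * lam) * ‖g‖ ^ 2 = 4 * (‖g‖ ^ 2 / (8 * lam)) := by
    field_simp
    ring
  linear_combination 1 * h2 + 2 * h3 + h4 - h5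

end Model

/-- If `s` grows by the factor `γ` outside of `A`, shrinks at most by `γ` on `A`, and is
eventually large on `A`, then it diverges. -/
theorem tendsto_atTop_of_growth {s : ℕ → ℝ} {γ : ℝ} (hγ : 1 < γ) (hs : ∀ k, 0 < s k) {A : Set ℕ}
    (hgrow : ∀ k, k ∉ A → s (k + 1) = γ * s k) (hshrink : ∀ k, s k ≤ γ * s (k + 1))
    (hA : ∀ C, ∀ᶠ k in atTop, k ∈ A → C ≤ s k) : Tendsto s atTop atTop := by
  have hγ0 : 0 < γ := by linarith
  refine tendsto_atTop.2 fun C' => ?_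
  set C := max C' 0 with hC
  -- With threshold `γ C`, a single shrinkage still leaves at least `C`.
  obtain ⟨K, hK⟩ := eventually_atTop.1 (hA (γ * C))
  have hCC : C ≤ γ * C := le_mul_of_one_le_left (le_max_right _ _) hγ.le
  -- Staying below `C` would exclude `A` forever and force geometric growth.
  have hex : ∃ k ≥ K, C ≤ s k := by
    by_contra! hcon
    have hnot : ∀ k ≥ K, k ∉ A := fun k hk hkA =>
      absurd (hCC.trans (hK k hk hkA)) (not_le.2 (hcon k hk))
    have hpow : ∀ j, s (K + j) = γ ^ j * s K := fun j => by
      induction j with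
      | zero => simp
      | succ j ih =>
        rw [← add_assoc, hgrow _ (hnot _ (Nat.le_add_right _ _)), ih, pow_succ]
        ring
    obtain ⟨j, hj⟩ := ((tendsto_pow_atTop_atTop_of_one_lt hγ).atTop_mul_const
      (hs K)).eventually_ge_atTop C |>.exists
    exact absurd hj (not_le.2 (hpow j ▸ hcon _ (Nat.le_add_right K j)))
  obtain ⟨k₀, hk₀, hCk₀⟩ := hex
  refine eventually_atTop.2 ⟨k₀, fun k hk => (le_max_left C' 0).trans ?_⟩
  induction k, hk using Nat.le_induction with
  | base => exact hCk₀
  | succ k hk ih =>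
    by_cases hkA : k ∈ A
    · exact le_of_mul_le_mul_left ((hK k (hk₀.trans hk) hkA).trans (hshrink k)) hγ0
    · rw [hgrow k hkA]
      exact ih.trans (le_mul_of_one_le_left (hs k).le hγ.le)

/-! ### Estimates along a run of the algorithm. -/

section Run

variable {E X Y Z : Type*} [MeasurableSpace Y] [NormedAddCommGroup E] [InnerProductSpace ℝ E]
  [FiniteDimensional ℝ E] {Q : LearningProblem E X Y Z} {M : Set E} {R : E → E → E} {θ₀ : E}
  {σ₀ σmin η₁ η₂ γ : ℝ} {t : Trajectory E}

namespace IsRun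

theorem θ_mem (ht : IsRun Q M R θ₀ σ₀ σmin η₁ η₂ γ t) (hR : IsRetraction M R) (hθ₀ : θ₀ ∈ M)
    (k : ℕ) : t.θ k ∈ M := by
  induction k with
  | zero => rwa [ht.θ_zero]
  | succ k ih =>
    rw [ht.θ_succ]
    split_ifs
    · exact hR.maps_to _ ih _ (ht.d_argmin k).1
    · exact ih

theorem σ_pos (ht : IsRun Q M R θ₀ σ₀ σmin η₁ η₂ γ t) (hσ₀ : 0 < σ₀) (hσmin : 0 < σmin)
    (hγ : 1 < γ) (k : ℕ) : 0 < t.σ k := by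
  induction k with
  | zero => rwa [ht.σ_zero]
  | succ k ih =>
    rw [ht.σ_succ]
    split_ifs
    · exact lt_max_of_lt_left hσmin
    · exact mul_pos (by linarith) ih

theorem σ_le_mul_succ (ht : IsRun Q M R θ₀ σ₀ σmin η₁ η₂ γ t) (hσ₀ : 0 < σ₀) (hσmin : 0 < σmin)
    (hγ : 1 < γ) (k : ℕ) : t.σ k ≤ γ * t.σ (k + 1) := by
  have hσ := ht.σ_pos hσ₀ hσmin hγ k
  have hγ0 : 0 < γ := by linarith
  rw [ht.σ_succ]
  split_ifs
  · calc t.σ k = γ * (1 / γ * t.σ k) := by field_simp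
      _ ≤ _ := by
        gcongr
        exact le_max_right _ _
  · exact (le_mul_of_one_le_left hσ.le hγ.le).trans
      (le_mul_of_one_le_left (mul_pos hγ0 hσ).le hγ.le)

variable {k : ℕ}

/-- At an iteration whose gradient estimate is not small, the predicted change is at least a
fixed fraction of `‖g^k‖ / σ_k`. -/
theorem predicted_le (ht : IsRun Q M R θ₀ σ₀ σmin η₁ η₂ γ t) (hη₂ : 0 < η₂) (hσ : 0 < t.σ k)
    (hF : ‖t.F k‖ ≤ η₂) (hg : η₂ / t.σ k ≤ ‖t.g k‖) :
    t.predicted k ≤ -(η₂ / (4 * t.σ k ^ 2)) := by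
  obtain ⟨hd, hmin⟩ := ht.d_argmin k
  have hg' : η₂ ≤ t.lam k := by
    rw [Trajectory.lam, mul_comm]
    exact (div_le_iff₀ hσ).1 hg
  have hgpos : 0 < ‖t.g k‖ := lt_of_lt_of_le (by positivity) hg
  have h := quadModel_decrease_of_isMinOn (ht.g_mem k) (hη₂.trans_le hg') (hF.trans hg') hmin
  have h1 : quadModel M (t.θ k) (t.est0 k) (t.g k) (t.F k) (t.lam k) ⟨t.d k, hd⟩ =
      t.est0 k + t.predicted k := by
    simp only [quadModel, Trajectory.predicted]
    ring
  have h2 : ‖t.g k‖ ^ 2 / (4 * t.lam k) = ‖t.g k‖ / (4 * t.σ k) := by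
    rw [Trajectory.lam]
    field_simp
  have h3 : η₂ / (4 * t.σ k ^ 2) ≤ ‖t.g k‖ / (4 * t.σ k) := by
    calc η₂ / (4 * t.σ k ^ 2) = (η₂ / t.σ k) / (4 * t.σ k) := by field_simp
      _ ≤ _ := by gcongr
  rw [h1, h2] at h
  linarith

theorem d_mem_tangentBall (ht : IsRun Q M R θ₀ σ₀ σmin η₁ η₂ γ t) (hσ : 0 < t.σ k)
    (hg : 0 < ‖t.g k‖) (hd : t.d k ∈ tangentSubspace M (t.θ k)) :
    (⟨t.d k, hd⟩ : tangentSubspace M (t.θ k)) ∈ tangentBall M (t.θ k) (1 / t.σ k) := by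
  obtain ⟨_, hmin⟩ := ht.d_argmin k
  have h := norm_le_of_isMinOn_quadModel (ht.F_est k).inner_nonneg (mul_pos hσ hg) hmin
  have h1 : ‖t.g k‖ / (t.σ k * ‖t.g k‖) = 1 / t.σ k := by field_simp
  rwa [h1] at h

/-- An accepted step decreases the objective by a fixed fraction of `1 / σ_k²`. -/
theorem loss_trial_le (ht : IsRun Q M R θ₀ σ₀ σmin η₁ η₂ γ t) (hη₁ : 0 < η₁) (hη₂ : 0 < η₂)
    (hσ : 0 < t.σ k) (hF : ‖t.F k‖ ≤ η₂) {εF : ℝ} (hεF : εF ≤ 1 / 32 * η₁ * η₂)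
    (hacc : t.IsAccurate Q.loss R εF k) (hg : η₂ / t.σ k ≤ ‖t.g k‖) (hρ : η₁ ≤ t.ratio k) :
    Q.loss (t.trial R k) + 3 / 16 * η₁ * η₂ / t.σ k ^ 2 ≤ Q.loss (t.θ k) := by
  have hp := ht.predicted_le hη₂ hσ hF hg
  have hpneg : t.predicted k < 0 := hp.trans_lt (neg_lt_zero.2 (by positivity))
  rw [Trajectory.ratio, le_div_iff_of_neg hpneg] at hρ
  have h1 := mul_le_mul_of_nonneg_left hp hη₁.le
  have h2 := (abs_le.1 hacc.1).2
  have h3 := (abs_le.1 hacc.2).1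
  -- In units of `η₁ η₂/(4σ²)`, the guaranteed estimated decrease is 1 and each of the two
  -- estimation errors at most `1/8`, leaving `3/4`.
  have h4 : εF / t.σ k ^ 2 ≤ 1 / 32 * η₁ * η₂ / t.σ k ^ 2 := by gcongr
  have h5 : 1 / 32 * η₁ * η₂ / t.σ k ^ 2 = 1 / 8 * (η₁ * (η₂ / (4 * t.σ k ^ 2))) := by
    field_simp
    ring
  have h6 : 3 / 16 * η₁ * η₂ / t.σ k ^ 2 = 3 / 4 * (η₁ * (η₂ / (4 * t.σ k ^ 2))) := by
    field_simp
    ring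
  rw [h6]
  linarith

/-- With a fully linear model, an iteration whose gradient estimate is not small is
successful. -/
theorem le_ratio (ht : IsRun Q M R θ₀ σ₀ σmin η₁ η₂ γ t) (hη₁ : η₁ < 1) (hη₂ : 0 < η₂)
    (hσ : 0 < t.σ k) (hF : ‖t.F k‖ ≤ η₂) {κef κeg εF : ℝ} (hκ : 16 * κef / (1 - η₁) ≤ η₂)
    (hεF : εF ≤ κef) (hacc : t.IsAccurate Q.loss R εF k)
    (hlin : IsFullyLinear M Q.loss R κef κeg (t.θ k) (t.σ k) (t.model M k) ∨
      IsFullyLinear M Q.loss R κef κeg (t.θ k) (t.σ k) (t.plainModel M k))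
    (hg : η₂ / t.σ k ≤ ‖t.g k‖) : η₁ ≤ t.ratio k := by
  have hp := ht.predicted_le hη₂ hσ hF hg
  have hpneg : t.predicted k < 0 := hp.trans_lt (neg_lt_zero.2 (by positivity))
  have hgpos : 0 < ‖t.g k‖ := lt_of_lt_of_le (by positivity) hg
  obtain ⟨hd, -⟩ := ht.d_argmin k
  have hball := ht.d_mem_tangentBall hσ hgpos hd
  have hq : Q.loss (t.trial R k) ≤ t.est0 k + t.predicted k + κef / t.σ k ^ 2 := by
    have hpull : pullback M Q.loss R (t.θ k) ⟨t.d k, hd⟩ = Q.loss (t.trial R k) := rfl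
    rcases hlin with hlin | hlin
    · have h := (abs_le.1 (hlin _ hball).2).2
      rw [hpull] at h
      simp only [Trajectory.model, quadModel] at h
      simp only [Trajectory.predicted]
      linarith
    · have h := (abs_le.1 (hlin _ hball).2).2
      rw [hpull] at h
      simp only [Trajectory.plainModel, quadModel, zero_smul, add_zero] at h
      simp only [Trajectory.predicted, inner_add_left, real_inner_smul_left,
        real_inner_self_eq_norm_sq]
      -- The regularization term missing from the plain model is nonnegative, so the upper bound
      -- survives.
      have hl : 0 ≤ t.lam k * ‖t.d k‖ ^ 2 :=
        mul_nonneg (mul_nonneg hσ.le (norm_nonneg _)) (sq_nonneg _)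
      linarith
  rw [Trajectory.ratio, le_div_iff_of_neg hpneg]
  have h3 := (abs_le.1 hacc.2).2
  have h4 : εF / t.σ k ^ 2 ≤ κef / t.σ k ^ 2 := by gcongr
  -- The model is anchored at `est0`, so only the model error and the error of `estz` enter:
  -- together at most `2κef/σ²`, half of the available `(1 - η₁) η₂/(4σ²)`.
  have hκ' : 16 * κef ≤ η₂ * (1 - η₁) := (div_le_iff₀ (by linarith)).1 hκ
  have h5 : 16 * κef / t.σ k ^ 2 ≤ η₂ * (1 - η₁) / t.σ k ^ 2 := by gcongr
  have h6 : η₂ * (1 - η₁) / t.σ k ^ 2 = 4 * ((1 - η₁) * (η₂ / (4 * t.σ k ^ 2))) := by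
    field_simp
  have h7 : 16 * κef / t.σ k ^ 2 = 16 * (κef / t.σ k ^ 2) := by ring
  have h8 := mul_le_mul_of_nonneg_left hp (sub_nonneg.2 hη₁.le)
  have h9 : 0 < (1 - η₁) * (η₂ / (4 * t.σ k ^ 2)) := mul_pos (by linarith) (by positivity)
  linarith

theorem norm_riemGrad_le (ht : IsRun Q M R θ₀ σ₀ σmin η₁ η₂ γ t) (hR : IsRetraction M R)
    (hQ : IsSmoothOn M Q.loss) (hθ₀ : θ₀ ∈ M) (hσ : 0 < t.σ k) {κef κeg : ℝ}
    (hlin : IsFullyLinear M Q.loss R κef κeg (t.θ k) (t.σ k) (t.model M k) ∨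
      IsFullyLinear M Q.loss R κef κeg (t.θ k) (t.σ k) (t.plainModel M k)) :
    ‖riemGrad M Q.loss (t.θ k)‖ ≤ ‖t.g k‖ + κeg / t.σ k := by
  have h0 : (0 : tangentSubspace M (t.θ k)) ∈ tangentBall M (t.θ k) (1 / t.σ k) := by
    simp [tangentBall, hσ.le]
  have hbound : ‖riemGrad M Q.loss (t.θ k) - ⟨t.g k, ht.g_mem k⟩‖ ≤ κeg / t.σ k := by
    rcases hlin with hlin | hlin
    · have h := (hlin 0 h0).1
      rwa [gradient_pullback_zero hR hQ (ht.θ_mem hR hθ₀ k), Trajectory.model,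
        gradient_quadModel_zero _ _ _ (ht.g_mem k)] at h
    · have h := (hlin 0 h0).1
      rwa [gradient_pullback_zero hR hQ (ht.θ_mem hR hθ₀ k), Trajectory.plainModel,
        gradient_quadModel_zero _ _ _ (ht.g_mem k)] at h
  have h := norm_le_norm_add_norm_sub (⟨t.g k, ht.g_mem k⟩ : tangentSubspace M (t.θ k))
    (riemGrad M Q.loss (t.θ k))
  rw [norm_sub_rev] at h
  exact h.trans (add_le_add le_rfl hbound)

theorem tendsto_σ (ht : IsRun Q M R θ₀ σ₀ σmin η₁ η₂ γ t) (hσ₀ : 0 < σ₀) (hσmin : 0 < σmin)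
    (hη₁ : 0 < η₁) (hη₂ : 0 < η₂) (hγ : 1 < γ)
    (hbdd : BddBelow (Set.range fun k => Q.loss (t.θ k))) (hF : ∀ k, ‖t.F k‖ ≤ η₂) {εF : ℝ}
    (hεF : εF ≤ 1 / 32 * η₁ * η₂) (hacc : ∀ k, t.IsAccurate Q.loss R εF k) :
    Tendsto t.σ atTop atTop := by
  have hσ := ht.σ_pos hσ₀ hσmin hγ
  set c := 3 / 16 * η₁ * η₂ with hc
  have hcpos : 0 < c := by positivity
  have hstep : ∀ k, η₁ ≤ t.ratio k ∧ η₂ / t.σ k ≤ ‖t.g k‖ →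
      Q.loss (t.θ (k + 1)) + c / t.σ k ^ 2 ≤ Q.loss (t.θ k) := fun k hk => by
    rw [ht.θ_succ, if_pos hk]
    exact ht.loss_trial_le hη₁ hη₂ (hσ k) (hF k) hεF (hacc k) hk.2 hk.1
  have hanti : Antitone fun k => Q.loss (t.θ k) := antitone_nat_of_succ_le fun k => by
    by_cases hk : η₁ ≤ t.ratio k ∧ η₂ / t.σ k ≤ ‖t.g k‖
    · have := hstep k hk
      have : 0 ≤ c / t.σ k ^ 2 := by positivity
      linarith
    · rw [ht.θ_succ, if_neg hk]
  have hlim := tendsto_atTop_ciInf hanti hbdd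
  have hdiff : Tendsto (fun k => Q.loss (t.θ k) - Q.loss (t.θ (k + 1))) atTop (𝓝 0) := by
    simpa using hlim.sub (hlim.comp (tendsto_add_atTop_nat 1))
  -- The strict inequality matters: at equality a step may be accepted although `σ` grows, so `A` is
  -- only a subset of the accepted iterations.
  refine tendsto_atTop_of_growth hγ hσ (A := {k | η₁ ≤ t.ratio k ∧ η₂ / t.σ k < ‖t.g k‖})
    (fun k hk => (ht.σ_succ k).trans (if_neg hk)) (ht.σ_le_mul_succ hσ₀ hσmin hγ) fun C => ?_
  have hpos : 0 < c / (|C| + 1) ^ 2 := by positivity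
  filter_upwards [hdiff.eventually_lt_const hpos] with k hk hkA
  have h1 := hstep k ⟨hkA.1, hkA.2.le⟩
  have h2 : c / t.σ k ^ 2 < c / (|C| + 1) ^ 2 := by linarith
  have hσk := hσ k
  have h3 : (|C| + 1) ^ 2 < t.σ k ^ 2 :=
    (div_lt_div_iff_of_pos_left hcpos (by positivity) (by positivity)).1 h2
  have h4 := lt_of_pow_lt_pow_left₀ 2 hσk.le h3
  linarith [le_abs_self C]

theorem frequently_norm_riemGrad_lt (ht : IsRun Q M R θ₀ σ₀ σmin η₁ η₂ γ t)
    (hR : IsRetraction M R) (hQ : IsSmoothOn M Q.loss) (hθ₀ : θ₀ ∈ M) (hσ₀ : 0 < σ₀)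
    (hσmin : 0 < σmin) (hη₁ : η₁ ∈ Set.Ioo (0 : ℝ) 1) (hη₂ : 0 < η₂) (hγ : 1 < γ)
    (hbdd : BddBelow (Set.range fun k => Q.loss (t.θ k))) (hF : ∀ k, ‖t.F k‖ ≤ η₂)
    {κef κeg εF : ℝ} (hκ : 16 * κef / (1 - η₁) ≤ η₂) (hεF : εF ≤ κef)
    (hεF' : εF ≤ 1 / 32 * η₁ * η₂) (hacc : ∀ k, t.IsAccurate Q.loss R εF k)
    (hlin : ∀ k, IsFullyLinear M Q.loss R κef κeg (t.θ k) (t.σ k) (t.model M k) ∨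
      IsFullyLinear M Q.loss R κef κeg (t.θ k) (t.σ k) (t.plainModel M k))
    {ε : ℝ} (hε : 0 < ε) : ∃ᶠ k in atTop, ‖riemGrad M Q.loss (t.θ k)‖ < ε := by
  intro hcon
  have hσ := ht.σ_pos hσ₀ hσmin hγ
  have hlim := ht.tendsto_σ hσ₀ hσmin hη₁.1 hη₂ hγ hbdd hF hεF' hacc
  have hsmall : ∀ᶠ k in atTop, η₂ / t.σ k + κeg / t.σ k < ε :=
    Tendsto.eventually_lt_const hε
      (by simpa using (hlim.const_div_atTop η₂).add (hlim.const_div_atTop κeg))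
  -- A gradient of norm at least `ε` forces `‖g^k‖ ≥ ε - κeg/σ_k > η₂/σ_k`, hence success.
  have hdec : ∀ᶠ k in atTop, t.σ (k + 1) ≤ max σmin (t.σ k) := by
    filter_upwards [hcon, hsmall] with k hk hk'
    have h1 := ht.norm_riemGrad_le hR hQ hθ₀ (hσ k) (hlin k)
    have hg : η₂ / t.σ k < ‖t.g k‖ := by linarith [not_lt.1 hk]
    have hρ := ht.le_ratio hη₁.2 hη₂ (hσ k) (hF k) hκ hεF (hacc k) (hlin k) hg.le
    rw [ht.σ_succ, if_pos ⟨hρ, hg⟩]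
    refine max_le_max le_rfl (mul_le_of_le_one_left (hσ k).le ?_)
    rw [div_le_one (by linarith)]
    exact hγ.le
  obtain ⟨K, hK⟩ := eventually_atTop.1 hdec
  have hbd : ∀ k ≥ K, t.σ k ≤ max σmin (t.σ K) := fun k hk => by
    induction k, hk using Nat.le_induction with
    | base => exact le_max_right _ _
    | succ k hk ih => exact (hK k hk).trans (max_le (le_max_left _ _) ih)
  obtain ⟨k, hk, hk'⟩ :=
    ((hlim.eventually_gt_atTop (max σmin (t.σ K))).and (eventually_ge_atTop K)).exists
  exact absurd (hbd k hk') (not_le.2 hk)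

end IsRun

end Run

end RNGD

theorem theorem5p1 {m n : ℕ} {X Y Z : Type*} [MeasurableSpace Y]
    (M : Set (MatrixSpace m n)) (hM : IsEmbeddedSubmanifold M)
    (R : MatrixSpace m n → MatrixSpace m n → MatrixSpace m n) (hR : IsRetraction M R)
    (Q : LearningProblem (MatrixSpace m n) X Y Z) (hQ : IsSmoothOn M Q.loss)
    (θ₀ : MatrixSpace m n) (hθ₀ : θ₀ ∈ M)
    (σ₀ σmin η₁ η₂ γ : ℝ) (hσ₀ : 0 < σ₀) (hσmin : 0 < σmin)
    (hη₁ : η₁ ∈ Set.Ioo (0 : ℝ) 1) (hη₂ : 0 < η₂) (hγ : 1 < γ)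
    {Ω : Type*} [MeasurableSpace Ω] (P : Measure Ω) [IsProbabilityMeasure P]
    (t : Ω → Trajectory (MatrixSpace m n))
    (hrun : ∀ᵐ ω ∂P, IsRun Q M R θ₀ σ₀ σmin η₁ η₂ γ (t ω))
    (L : ℝ≥0) (hreg : ∀ᵐ ω ∂P, (t ω).IsRegular M Q.loss R σmin L)
    (κfim : ℝ) (hfim : ∀ᵐ ω ∂P, ∀ k, ‖(t ω).F k‖ ≤ κfim)
    (κef κeg : ℝ) (hκef : 0 < κef) (hκeg : 0 < κeg)
    (hlin : ∀ᵐ ω ∂P, ∀ k,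
      IsFullyLinear M Q.loss R κef κeg ((t ω).θ k) ((t ω).σ k) ((t ω).model M k) ∨
      IsFullyLinear M Q.loss R κef κeg ((t ω).θ k) ((t ω).σ k) ((t ω).plainModel M k))
    (εF : ℝ) (hεF : 0 < εF)
    (hacc : ∀ᵐ ω ∂P, ∀ k, (t ω).IsAccurate Q.loss R εF k)
    (hη₂' : max κfim (16 * κef / (1 - η₁)) ≤ η₂)
    (hεF' : εF ≤ min κef (1 / 32 * η₁ * η₂)) :
    ∀ᵐ ω ∂P, liminf (fun k => ‖riemGrad M Q.loss ((t ω).θ k)‖ₑ) atTop = 0 := by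
  filter_upwards [hrun, hreg, hfim, hlin, hacc] with ω hrun hreg hfim hlin hacc
  -- In `ℝ≥0∞` the liminf needs no boundedness, so being below every `ε` infinitely often suffices.
  refine le_antisymm (ENNReal.le_of_forall_pos_le_add fun ε hε _ => ?_) bot_le
  rw [zero_add]
  have hfreq := hrun.frequently_norm_riemGrad_lt hR hQ hθ₀ hσ₀ hσmin hη₁ hη₂ hγ hreg.1
    (fun k => (hfim k).trans ((le_max_left _ _).trans hη₂')) ((le_max_right _ _).trans hη₂')
    (hεF'.trans (min_le_left _ _)) (hεF'.trans (min_le_right _ _)) hacc hlin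
    (NNReal.coe_pos.2 hε)
  refine liminf_le_of_frequently_le' (hfreq.mono fun k hk => ?_)
  rw [← ofReal_norm]
  exact ENNReal.ofReal_le_of_le_toReal hk.le
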